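/- Let $\mathcal D=\mathcal X\times[p]\times\{-1,1\}$, where $\mathcal X$ is a measurable space, let $\Im$ be a probability distribution on $\mathcal D$, let $N\ge 1$ and $\lambda>0$. Let $\phi:\mathcal X\to\mathbb R^d$ be a feature map, and let $\mathcal F=\{f=\alpha^\top\phi(\cdot):\alpha\in\mathbb R^d\}$ be the family of linear classifiers, i.e. the reproducing kernel Hilbert space with kernel $k(x,y)=\langle\phi(x),\phi(y)\rangle$ and norm $\|\cdot\|_k$. Let $\Omega:\mathcal F\to\mathbb R^a$ be convex (componentwise) and not dependent on the training set. Let $L:\mathcal F\times\mathcal D\to\mathbb R$ be a loss function such that, for every $s\in\mathcal D$, $f\mapsto L(f,s)$ is convex and $\alpha\mapsto L(\alpha^\top\phi(\cdot),s)$ is differentiable, and such that $L(f,\cdot)$ is $\Im$-integrable for every $f\in\mathcal F$ with $\Omega(f)\le 0$. Suppose that $$G=\sup_{f=\alpha^\top\phi(\cdot)\in\mathcal F:\ \Omega(f)\le 0}\ \sup_{s\in\mathcal D}\ \|\nabla_\alpha L(f,s)\|_2<\infty .$$ Write $R(f)=\mathbb E_{s\sim\Im}[L(f,s)]$ and, for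 a training set $S=(s_1,\dots,s_N)\in\mathcal D^N$, $E(f)=\frac1N\sum_{i=1}^N L(f,s_i)$. Let $\mathcal A$ be an algorithm that computes, for every $S\in\mathcal D^N$, a minimizer $\mathcal A_S$ of $$\min_{f\in\mathcal F}\ \frac1N\sum_{i=1}^N L(f,s_i)+\lambda\|f\|_k^2\quad\text{subject to}\quad \Omega(f)\le 0 .$$ Then: 1. $R(\mathcal A_S)-E(\mathcal A_S)$ is integrable with respect to $S\sim\Im^N$, and $$\mathbb E_{S\sim\Im^N}\big[R(\mathcal A_S)-E(\mathcal A_S)\big]\le\frac{G^2}{\lambda N}.$$ 2. If moreover $0\le L(\mathcal A_S,s)\le 1$ for all $S\in\mathcal D^N$ and $s\in\mathcal D$, then for every $\delta\in(0,1)$, with probability at least $1-\delta$ over $S\sim\Im^N$, $$R(\mathcal A_S)\le E(\mathcal A_S)+8\sqrt{\Big(\frac{2G^2}{\lambda N}+\frac1N\Big)\ln(8/\delta)} .$$ -/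

import Mathlib

open MeasureTheory

namespace StableFair

/-- Samples `(x, z, y)`: a feature vector `x : X`, a sensitive attribute `z` with `p` possible
values, and a label `y ∈ {-1, 1}`. -/
abbrev Sample (X : Type*) (p : ℕ) : Type _ := X × Fin p × ({-1, 1} : Set ℝ)

section LinearModel

variable {X : Type*} {d : ℕ} (H : Type*) [NormedAddCommGroup H] [InnerProductSpace ℝ H]
  [CompleteSpace H] [RKHS ℝ H X ℝ]

/-- `φ : X → ℝ^d` is a feature map of the reproducing kernel Hilbert space `H` of real-valued
functions on `X`: the (scalar) kernel of `H` is `k(x, y) = ⟨φ(x), φ(y)⟩`. -/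
def IsFeatureMap (φ : X → EuclideanSpace ℝ (Fin d)) : Prop :=
  ∀ x y : X, RKHS.kernel H x y 1 = inner ℝ (φ x) (φ y)

variable {H}

/-- The RKHS with kernel `⟨φ(x), φ(y)⟩` contains all the linear classifiers `α^⊤ φ(·)`. -/
theorem exists_linearClassifier {φ : X → EuclideanSpace ℝ (Fin d)} (hφ : IsFeatureMap H φ)
    (α : EuclideanSpace ℝ (Fin d)) : ∃ f : H, ∀ x, f x = inner ℝ α (φ x) := by
  let V : Submodule ℝ (EuclideanSpace ℝ (Fin d)) := Submodule.span ℝ (Set.range φ)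
  have key : ∀ v ∈ V, ∃ f : H, ∀ x, f x = inner ℝ v (φ x) := by
    intro v hv
    induction hv using Submodule.span_induction with
    | mem v hv =>
      obtain ⟨y, rfl⟩ := hv
      refine ⟨RKHS.kerFun H y 1, fun x => ?_⟩
      rw [RKHS.kerFun_apply, hφ, real_inner_comm]
    | zero => exact ⟨0, fun x => by simp⟩
    | add u v _ _ hu hv =>
      obtain ⟨f, hf⟩ := hu
      obtain ⟨g, hg⟩ := hv
      exact ⟨f + g, fun x => by simp [hf, hg, inner_add_left]⟩
    | smul c v _ hv =>
      obtain ⟨f, hf⟩ := hv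
      exact ⟨c • f, fun x => by simp [hf, inner_smul_left]⟩
  obtain ⟨f, hf⟩ := key (V.starProjection α) (V.starProjection_apply_mem α)
  refine ⟨f, fun x => ?_⟩
  have h := V.sub_starProjection_mem_orthogonal α
  have h0 := (Submodule.mem_orthogonal' V _).1 h (φ x) (Submodule.subset_span ⟨x, rfl⟩)
  rw [inner_sub_left] at h0
  rw [hf]
  linarith

/-- The linear classifier `α^⊤ φ(·)`, as an element of the RKHS. -/
noncomputable def linearClassifier {φ : X → EuclideanSpace ℝ (Fin d)} (hφ : IsFeatureMap H φ)
    (α : EuclideanSpace ℝ (Fin d)) : H :=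
  Classical.choose (exists_linearClassifier hφ α)

theorem linearClassifier_apply {φ : X → EuclideanSpace ℝ (Fin d)} (hφ : IsFeatureMap H φ)
    (α : EuclideanSpace ℝ (Fin d)) (x : X) : linearClassifier hφ α x = inner ℝ α (φ x) :=
  Classical.choose_spec (exists_linearClassifier hφ α) x

/-- The set of all the numbers `‖∇_α L(f, s)‖₂`, where `f = α^⊤ φ(·)` runs over the classifiers
with `Ω(f) ≤ 0` and `s` over all samples. -/
noncomputable def gradientNorms {p a : ℕ} {φ : X → EuclideanSpace ℝ (Fin d)}
    (hφ : IsFeatureMap H φ) (L : H → Sample X p → ℝ) (Ω : H → Fin a → ℝ) : Set ℝ :=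
  {r | ∃ (α : EuclideanSpace ℝ (Fin d)) (s : Sample X p), Ω (linearClassifier hφ α) ≤ 0 ∧
    r = ‖gradient (fun α' => L (linearClassifier hφ α') s) α‖}

/-- `G`, the supremum of `‖∇_α L(f, s)‖₂` over the classifiers `f` with `Ω(f) ≤ 0` and over all
samples `s`. -/
noncomputable def gradientBound {p a : ℕ} {φ : X → EuclideanSpace ℝ (Fin d)}
    (hφ : IsFeatureMap H φ) (L : H → Sample X p → ℝ) (Ω : H → Fin a → ℝ) : ℝ :=
  sSup (gradientNorms hφ L Ω)

end LinearModel

/-- The expected risk `R(f) = 𝔼_{s ∼ μ} [L(f, s)]`. -/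
noncomputable def expectedRisk {X H : Type*} {p : ℕ} [MeasurableSpace X]
    (μ : Measure (Sample X p)) (L : H → Sample X p → ℝ) (f : H) : ℝ :=
  ∫ s, L f s ∂μ

/-- The empirical risk `E(f) = (1/N) ∑ i, L(f, s_i)` on the training set `S = (s_1, …, s_N)`. -/
noncomputable def empiricalRisk {X H : Type*} {p N : ℕ}
    (L : H → Sample X p → ℝ) (S : Fin N → Sample X p) (f : H) : ℝ :=
  (1 / (N : ℝ)) * ∑ i, L f (S i)

/-- The algorithm `A` computes, for every training set `S` of size `N`, a minimizer `A S` of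
`(1/N) ∑ i, L(f, s_i) + lam * ‖f‖²` over all `f` in the RKHS with `Ω(f) ≤ 0`. -/
def SolvesStableFair {X H : Type*} [NormedAddCommGroup H] {p a N : ℕ}
    (L : H → Sample X p → ℝ) (Ω : H → Fin a → ℝ) (lam : ℝ)
    (A : (Fin N → Sample X p) → H) : Prop :=
  ∀ S : Fin N → Sample X p, Ω (A S) ≤ 0 ∧
    ∀ f : H, Ω f ≤ 0 →
      empiricalRisk L S (A S) + lam * ‖A S‖ ^ 2 ≤ empiricalRisk L S f + lam * ‖f‖ ^ 2

end StableFair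

namespace StableFair

open Filter Topology ProbabilityTheory

/-! ### Uniform stability of the regularized minimizer. -/

section Stability

/-! The term `lam * ‖f‖ ^ 2` makes the objective grow quadratically around its minimizer, and the
loss is `G`-Lipschitz in the RKHS norm. Replacing one sample therefore moves the minimizer by at
most `G / (lam * N)` and every loss by at most `γ = G ^ 2 / (lam * N)`
(`abs_loss_sub_le_of_eqOn_compl`). Both bounds then follow from exchanging a training sample with a
fresh one (`integral_mul_riskGap_le`). With weight `1` this bounds the mean gap by `γ`. With weight
`exp (t * gap)` it gives `M' ≤ (b * t + γ) * M` for the moment generating function `M` of the gap,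
where `b = 2 * γ + 1 / N`; integrating this (`mgf_riskGap_le`) and applying Chernoff gives the tail
bound. The algorithm is not assumed measurable: quadratic growth makes its output an almost
everywhere limit of measurably selected approximate minimizers
(`exists_measurable_approx_minimizer`). -/

theorem tendsto_loss_of_lipschitz {Z H : Type*} [NormedAddCommGroup H] {C : Set H}
    {L : H → Z → ℝ} {G : ℝ}
    (hlip : ∀ z, ∀ f ∈ C, ∀ g ∈ C, |L f z - L g z| ≤ G * ‖f - g‖) {u : ℕ → H} {f : H}
    (hu : ∀ n, u n ∈ C) (hf : f ∈ C) (h : Tendsto u atTop (𝓝 f)) (z : Z) :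
    Tendsto (fun n => L (u n) z) atTop (𝓝 (L f z)) := by
  rw [tendsto_iff_norm_sub_tendsto_zero] at h ⊢
  refine squeeze_zero (fun _ => norm_nonneg _) (fun n => hlip z _ (hu n) _ hf) ?_
  simpa using h.const_mul G

variable {Z H : Type*} [NormedAddCommGroup H] [InnerProductSpace ℝ H] {N : ℕ}

/-- Quadratic growth of a strongly convex objective around its minimizer. -/
theorem add_sq_norm_sub_le_of_isMinOn {C : Set H} {E : H → ℝ} {lam : ℝ} {a f : H}
    (hE : ConvexOn ℝ C E) (ha : a ∈ C) (hf : f ∈ C)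
    (hmin : IsMinOn (fun g => E g + lam * ‖g‖ ^ 2) C a) :
    E a + lam * ‖a‖ ^ 2 + lam * ‖f - a‖ ^ 2 ≤ E f + lam * ‖f‖ ^ 2 := by
  by_contra! hlt
  set D := lam * ‖f - a‖ ^ 2 with hD
  set K := E f + lam * ‖f‖ ^ 2 - (E a + lam * ‖a‖ ^ 2) with hK
  have hK0 : 0 ≤ K := sub_nonneg.2 (hmin hf)
  have hKD : K < D := by linarith
  have hDpos : 0 < D := hK0.trans_lt hKD
  -- Minimality along the segment gives `(1 - t) * D ≤ K`; this `t` makes the left side `(D + K) /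
  -- 2`, which exceeds `K`.
  obtain ⟨t, ht⟩ : ∃ t, t = (D - K) / (2 * D) := ⟨_, rfl⟩
  have htD : t * (2 * D) = D - K := by rw [ht]; field_simp
  have ht0 : 0 < t := by rw [ht]; exact div_pos (by linarith) (by linarith)
  have ht1 : t ≤ 1 := by rw [ht, div_le_one (by linarith)]; linarith
  have hconv := hE.2 ha hf (sub_nonneg.2 ht1) ht0.le (by ring)
  have hm : E a + lam * ‖a‖ ^ 2 ≤ E ((1 - t) • a + t • f) + lam * ‖(1 - t) • a + t • f‖ ^ 2 :=
    hmin (hE.1 ha hf (sub_nonneg.2 ht1) ht0.le (by ring))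
  have hnorm : ‖(1 - t) • a + t • f‖ ^ 2
      = (1 - t) * ‖a‖ ^ 2 + t * ‖f‖ ^ 2 - t * (1 - t) * ‖f - a‖ ^ 2 := by
    rw [norm_add_sq_real, norm_sub_sq_real, norm_smul, norm_smul, inner_smul_left,
      inner_smul_right, mul_pow, mul_pow, Real.norm_eq_abs, Real.norm_eq_abs, sq_abs, sq_abs,
      real_inner_comm]
    simp
    ring
  rw [hnorm] at hm
  simp only [smul_eq_mul] at hconv
  have h1 : t * ((1 - t) * D) ≤ t * K := by
    rw [hD, hK]; linarith
  have h2 := le_of_mul_le_mul_left h1 ht0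
  linarith

variable {C : Set H} {L : H → Z → ℝ} {G lam : ℝ} {A : (Fin N → Z) → H}

theorem convexOn_average (hL : ∀ z, ConvexOn ℝ C (fun f => L f z)) (hC : Convex ℝ C)
    (S : Fin N → Z) : ConvexOn ℝ C (fun f => (1 / (N : ℝ)) * ∑ i, L f (S i)) := by
  have h : ConvexOn ℝ C (fun f => ∑ i, L f (S i)) := by
    refine ⟨hC, fun x hx y hy s t hs ht hst => ?_⟩
    simp only [smul_eq_mul, Finset.mul_sum, ← Finset.sum_add_distrib]
    exact Finset.sum_le_sum fun i _ => (hL (S i)).2 hx hy hs ht hst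
  exact h.smul (c := 1 / (N : ℝ)) (by positivity)

/-- The regularized minimizers of two training sets that agree outside of `T` are close. -/
theorem mul_norm_sub_le_of_eqOn_compl (hC : Convex ℝ C)
    (hL : ∀ z, ConvexOn ℝ C (fun f => L f z)) (hG : 0 ≤ G)
    (hlip : ∀ z, ∀ f ∈ C, ∀ g ∈ C, |L f z - L g z| ≤ G * ‖f - g‖)
    (hAC : ∀ S, A S ∈ C)
    (hA : ∀ S, IsMinOn (fun f => (1 / (N : ℝ)) * ∑ i, L f (S i) + lam * ‖f‖ ^ 2) C (A S))
    {S S' : Fin N → Z} (T : Finset (Fin N)) (hST : ∀ i ∉ T, S i = S' i) :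
    lam * ‖A S - A S'‖ ≤ G * (T.card / N) := by
  have h1 := add_sq_norm_sub_le_of_isMinOn (convexOn_average hL hC S) (hAC S) (hAC S') (hA S)
  have h2 := add_sq_norm_sub_le_of_isMinOn (convexOn_average hL hC S') (hAC S') (hAC S)
    (hA S')
  rw [norm_sub_rev] at h1
  obtain ⟨D, hD⟩ : ∃ D, D = ‖A S - A S'‖ := ⟨_, rfl⟩
  have hD0 : 0 ≤ D := hD ▸ norm_nonneg _
  rw [← hD] at h1 h2 ⊢
  -- Adding `h1` and `h2` cancels the regularizers and leaves `2 * lam * D ^ 2` against these loss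
  -- differences, which vanish off `T`.
  have hsum : ∑ i, (L (A S') (S i) - L (A S) (S i) + (L (A S) (S' i) - L (A S') (S' i)))
      ≤ T.card * (2 * (G * D)) := by
    rw [← Finset.sum_subset (Finset.subset_univ T)
      (fun i _ hi => by rw [hST i hi]; ring), ← nsmul_eq_mul]
    refine Finset.sum_le_card_nsmul _ _ _ fun i _ => ?_
    have e1 := (abs_le.1 (hlip (S i) _ (hAC S) _ (hAC S'))).1
    have e2 := (abs_le.1 (hlip (S' i) _ (hAC S) _ (hAC S'))).2
    rw [← hD] at e1 e2
    linarith
  simp only [Finset.sum_add_distrib, Finset.sum_sub_distrib] at hsum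
  have hs := mul_le_mul_of_nonneg_left hsum (show 0 ≤ 1 / (N : ℝ) by positivity)
  have key : 2 * (lam * D ^ 2) ≤ 1 / (N : ℝ) * (T.card * (2 * (G * D))) := by
    simp only [mul_add, mul_sub] at hs
    linarith
  rcases hD0.eq_or_lt with h | h
  · rw [← h]; simp only [mul_zero]; positivity
  · refine le_of_mul_le_mul_right ?_ h
    have : 1 / (N : ℝ) * (T.card * (2 * (G * D))) = 2 * (G * (T.card / N) * D) := by ring
    rw [this] at key
    linarith

/-- A singleton `T` yields stability; `T = univ` yields a bound uniform over all training sets, used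
for integrability. -/
theorem abs_loss_sub_le_of_eqOn_compl (hC : Convex ℝ C)
    (hL : ∀ z, ConvexOn ℝ C (fun f => L f z)) (hG : 0 ≤ G)
    (hlip : ∀ z, ∀ f ∈ C, ∀ g ∈ C, |L f z - L g z| ≤ G * ‖f - g‖) (hlam : 0 < lam)
    (hAC : ∀ S, A S ∈ C)
    (hA : ∀ S, IsMinOn (fun f => (1 / (N : ℝ)) * ∑ i, L f (S i) + lam * ‖f‖ ^ 2) C (A S))
    {S S' : Fin N → Z} (T : Finset (Fin N)) (hST : ∀ i ∉ T, S i = S' i) (z : Z) :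
    |L (A S) z - L (A S') z| ≤ G ^ 2 / lam * (T.card / N) := by
  have h := mul_norm_sub_le_of_eqOn_compl hC hL hG hlip hAC hA T hST
  refine (hlip z _ (hAC S) _ (hAC S')).trans ?_
  have h' : ‖A S - A S'‖ ≤ G * (T.card / N) / lam := by
    rw [le_div_iff₀ hlam]; linarith
  refine (mul_le_mul_of_nonneg_left h' hG).trans (le_of_eq ?_)
  ring

end Stability

/-! ### Measurability of the loss at the minimizer. -/

section Measurability

variable {Z H : Type*} [MeasurableSpace Z] [NormedAddCommGroup H] [InnerProductSpace ℝ H] {N : ℕ}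
  {μ : Measure Z} [IsProbabilityMeasure μ]
  {C : Set H} {L : H → Z → ℝ} {G lam : ℝ} {A : (Fin N → Z) → H}

theorem ae_pi_forall_eval {p : Z → Prop} (hp : ∀ᵐ z ∂μ, p z) :
    ∀ᵐ S ∂(Measure.pi fun _ : Fin N => μ), ∀ i, p (S i) :=
  ae_all_iff.2 fun i => (Measure.quasiMeasurePreserving_eval (fun _ : Fin N => μ) i).ae hp

/-- Almost everywhere, the regularized minimizer is a limit of approximate minimizers that are
chosen measurably from a fixed countable family. -/
theorem exists_measurable_approx_minimizer (hC : Convex ℝ C) (hCs : TopologicalSpace.IsSeparable C)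
    (hL : ∀ z, ConvexOn ℝ C (fun f => L f z))
    (hlip : ∀ z, ∀ f ∈ C, ∀ g ∈ C, |L f z - L g z| ≤ G * ‖f - g‖)
    (hLm : ∀ f ∈ C, AEMeasurable (L f) μ) (hlam : 0 < lam) (hAC : ∀ S, A S ∈ C)
    (hA : ∀ S, IsMinOn (fun f => (1 / (N : ℝ)) * ∑ i, L f (S i) + lam * ‖f‖ ^ 2) C (A S)) :
    ∃ (u : ℕ → H) (g : ℕ → Z → ℝ) (n : ℕ → (Fin N → Z) → ℕ), (∀ m, u m ∈ C) ∧
      (∀ m, Measurable (g m)) ∧ (∀ k, Measurable (n k)) ∧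
      (∀ᵐ z ∂μ, ∀ m, L (u m) z = g m z) ∧
      ∀ᵐ S ∂(Measure.pi fun _ : Fin N => μ), Tendsto (fun k => u (n k S)) atTop (𝓝 (A S)) := by
  classical
  obtain ⟨Z0⟩ : Nonempty Z := μ.nonempty_of_neZero
  obtain ⟨t, htC, htc, hCt⟩ := hCs.exists_countable_dense_subset
  have htne : t.Nonempty := closure_nonempty_iff.1 ⟨_, hCt (hAC fun _ => Z0)⟩
  obtain ⟨u, rfl⟩ := htc.exists_eq_range htne
  have huC : ∀ m, u m ∈ C := fun m => htC ⟨m, rfl⟩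
  -- Measurable versions of countably many losses, so one null set suffices for all of them.
  let g : ℕ → Z → ℝ := fun m => (hLm (u m) (huC m)).mk
  have hg : ∀ m, Measurable (g m) := fun m => (hLm (u m) (huC m)).measurable_mk
  have hLg : ∀ᵐ z ∂μ, ∀ m, L (u m) z = g m z :=
    ae_all_iff.2 fun m => (hLm (u m) (huC m)).ae_eq_mk
  let h : ℕ → (Fin N → Z) → ℝ := fun m S => (1 / (N : ℝ)) * ∑ i, g m (S i) + lam * ‖u m‖ ^ 2
  have hh : ∀ m, Measurable (h m) := fun m =>
    ((Finset.measurable_fun_sum _ fun i _ =>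
      (hg m).comp (measurable_pi_apply i)).const_mul _).add_const _
  let q : ℕ → ℕ → (Fin N → Z) → Prop := fun k j S => ∀ m, h j S ≤ h m S + 1 / ((k : ℝ) + 1)
  have hq : ∀ k j, MeasurableSet {S | q k j S} := fun k j =>
    by
      rw [show {S | q k j S} = ⋂ m, {S | h j S ≤ h m S + 1 / ((k : ℝ) + 1)} by ext; simp [q]]
      exact MeasurableSet.iInter fun m => measurableSet_le (hh j) ((hh m).add_const _)
  have hq' : ∀ k, MeasurableSet {S | ∃ j, q k j S} := fun k => by
    rw [show {S | ∃ j, q k j S} = ⋃ j, {S | q k j S} by ext; simp]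
    exact MeasurableSet.iUnion (hq k)
  -- The second alternative only makes `Nat.find` total; `hqex` excludes it off the null set.
  have hex : ∀ k S, ∃ j, q k j S ∨ ¬ ∃ j, q k j S := fun k S => by
    by_cases H' : ∃ j, q k j S
    · exact H'.imp fun _ => Or.inl
    · exact ⟨0, Or.inr H'⟩
  refine ⟨u, g, fun k S => Nat.find (hex k S), huC, hg, fun k => measurable_find (hex k) fun j =>
    (hq k j).union (hq' k).compl, hLg, ?_⟩
  filter_upwards [ae_pi_forall_eval (N := N) hLg] with S hS
  have hhS : ∀ m, h m S = (1 / (N : ℝ)) * ∑ i, L (u m) (S i) + lam * ‖u m‖ ^ 2 := fun m => by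
    simp only [h]
    congr 2
    exact Finset.sum_congr rfl fun i _ => (hS i m).symm
  -- By density and continuity, the infimum over the countable family is the minimum over `C`.
  have happrox : ∀ ε > 0, ∃ m, h m S <
      (1 / (N : ℝ)) * ∑ i, L (A S) (S i) + lam * ‖A S‖ ^ 2 + ε := by
    intro ε hε
    obtain ⟨v, hv, hvl⟩ := mem_closure_iff_seq_limit.1 (hCt (hAC S))
    have hlim : Tendsto (fun k => (1 / (N : ℝ)) * ∑ i, L (v k) (S i) + lam * ‖v k‖ ^ 2) atTop
        (𝓝 ((1 / (N : ℝ)) * ∑ i, L (A S) (S i) + lam * ‖A S‖ ^ 2)) :=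
      ((tendsto_finsetSum _ fun i _ => tendsto_loss_of_lipschitz hlip (fun k => htC (hv k))
        (hAC S) hvl (S i)).const_mul _).add ((hvl.norm.pow 2).const_mul _)
    obtain ⟨k, hk⟩ := (hlim.eventually (gt_mem_nhds (lt_add_of_pos_right _ hε))).exists
    obtain ⟨m, hm⟩ := hv k
    exact ⟨m, by rw [hhS, hm]; exact hk⟩
  have hqex : ∀ k, ∃ j, q k j S := fun k => by
    obtain ⟨j, hj⟩ := happrox (1 / ((k : ℝ) + 1)) (by positivity)
    refine ⟨j, fun m => hj.le.trans ?_⟩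
    have := isMinOn_iff.1 (hA S) _ (huC m)
    rw [hhS m]
    linarith
  have hbound : ∀ k, lam * ‖u (Nat.find (hex k S)) - A S‖ ^ 2 ≤ 1 / ((k : ℝ) + 1) := fun k => by
    have hk : q k (Nat.find (hex k S)) S :=
      (Nat.find_spec (hex k S)).resolve_right (not_not.2 (hqex k))
    have hgrow := add_sq_norm_sub_le_of_isMinOn (convexOn_average hL hC S) (hAC S)
      (huC (Nat.find (hex k S))) (hA S)
    rw [← hhS] at hgrow
    refine le_of_forall_pos_le_add fun ε hε => ?_
    obtain ⟨m, hm⟩ := happrox ε hε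
    have := hk m
    linarith
  rw [tendsto_iff_norm_sub_tendsto_zero]
  have hsq : Tendsto (fun k => ‖u (Nat.find (hex k S)) - A S‖ ^ 2) atTop (𝓝 0) := by
    refine squeeze_zero (fun _ => by positivity) (fun k => ?_)
      (by simpa using (tendsto_one_div_add_atTop_nhds_zero_nat (𝕜 := ℝ)).const_mul lam⁻¹)
    rw [← div_eq_inv_mul, le_div_iff₀ hlam]
    rw [mul_comm]
    simpa using hbound k
  simpa [Real.sqrt_sq] using hsq.sqrt

/-- The selected indices lie in `ℕ`, so evaluating `g` at them is measurable, and the Lipschitz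
bound passes to the limit. The second claim is separate because the law of `(S, S i)` need not be
absolutely continuous with respect to the product measure. -/
theorem aemeasurable_loss_minimizer (hC : Convex ℝ C) (hCs : TopologicalSpace.IsSeparable C)
    (hL : ∀ z, ConvexOn ℝ C (fun f => L f z))
    (hlip : ∀ z, ∀ f ∈ C, ∀ g ∈ C, |L f z - L g z| ≤ G * ‖f - g‖)
    (hLm : ∀ f ∈ C, AEMeasurable (L f) μ) (hlam : 0 < lam) (hAC : ∀ S, A S ∈ C)
    (hA : ∀ S, IsMinOn (fun f => (1 / (N : ℝ)) * ∑ i, L f (S i) + lam * ‖f‖ ^ 2) C (A S)) :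
    AEMeasurable (fun q : (Fin N → Z) × Z => L (A q.1) q.2)
        ((Measure.pi fun _ : Fin N => μ).prod μ) ∧
      ∀ i, AEMeasurable (fun S => L (A S) (S i)) (Measure.pi fun _ : Fin N => μ) := by
  obtain ⟨u, g, n, huC, hg, hn, hLg, hlim⟩ :=
    exists_measurable_approx_minimizer hC hCs hL hlip hLm hlam hAC hA
  have hgm : Measurable fun p : Z × ℕ => g p.2 p.1 := measurable_from_prod_countable_left hg
  refine ⟨aemeasurable_of_tendsto_metrizable_ae atTop
    (f := fun k (q : (Fin N → Z) × Z) => g (n k q.1) q.2) (fun k => (hgm.comp (measurable_snd.prodMk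
      ((hn k).comp measurable_fst))).aemeasurable) ?_,
    fun i => aemeasurable_of_tendsto_metrizable_ae atTop
    (f := fun k (S : Fin N → Z) => g (n k S) (S i)) (fun k => (hgm.comp ((measurable_pi_apply i).prodMk
      (hn k))).aemeasurable) ?_⟩
  · filter_upwards [Measure.quasiMeasurePreserving_fst.ae hlim,
      Measure.quasiMeasurePreserving_snd.ae hLg] with q hq1 hq2
    simp only [← hq2]
    exact tendsto_loss_of_lipschitz hlip (fun _ => huC _) (hAC _) hq1 _
  · filter_upwards [hlim, ae_pi_forall_eval (N := N) hLg] with S hS1 hS2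
    simp only [← hS2]
    exact tendsto_loss_of_lipschitz hlip (fun _ => huC _) (hAC _) hS1 _

end Measurability

/-! ### Generalization of uniformly stable algorithms. -/

section Generalization

variable {Z : Type*} [MeasurableSpace Z] {N : ℕ} {μ : Measure Z} [IsProbabilityMeasure μ]

/-- The preimage of a box leaves coordinate `i` of the old sample free and constrains the fresh
point instead. -/
theorem measurePreserving_update (i : Fin N) :
    MeasurePreserving (fun q : (Fin N → Z) × Z => Function.update q.1 i q.2)
      ((Measure.pi fun _ : Fin N => μ).prod μ) (Measure.pi fun _ : Fin N => μ) := by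
  classical
  have hm : Measurable (fun q : (Fin N → Z) × Z => Function.update q.1 i q.2) := by
    refine measurable_pi_iff.2 fun j => ?_
    by_cases h : j = i
    · subst h; simpa using measurable_snd
    · simpa [Function.update_of_ne h, Function.comp_def] using
        (measurable_pi_apply j).comp (measurable_fst (α := Fin N → Z) (β := Z))
  refine ⟨hm, (Measure.pi_eq fun s hs => ?_).symm⟩
  rw [Measure.map_apply hm (MeasurableSet.univ_pi hs)]
  have hset : (fun q : (Fin N → Z) × Z => Function.update q.1 i q.2) ⁻¹' Set.univ.pi s
      = (Set.univ.pi (Function.update s i Set.univ)) ×ˢ s i := by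
    ext q
    simp only [Set.mem_preimage, Set.mem_univ_pi, Set.mem_prod]
    constructor
    · intro h
      refine ⟨fun j => ?_, by simpa using h i⟩
      by_cases hj : j = i
      · subst hj; simp
      · simpa [Function.update_of_ne hj] using h j
    · rintro ⟨h1, h2⟩ j
      by_cases hj : j = i
      · subst hj; simpa using h2
      · simpa [Function.update_of_ne hj] using h1 j
  rw [hset, Measure.prod_prod, Measure.pi_pi,
    ← Finset.mul_prod_erase Finset.univ (fun j => μ (s j)) (Finset.mem_univ i),
    ← Finset.mul_prod_erase Finset.univ (fun j => μ (Function.update s i Set.univ j))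
      (Finset.mem_univ i), Function.update_self, measure_univ, one_mul, mul_comm]
  congr 1
  exact Finset.prod_congr rfl fun j hj => by
    rw [Function.update_of_ne (Finset.ne_of_mem_erase hj)]

/-- The gap between the expected and the empirical risk, for a loss `ℓ S` that depends on the
training set `S`. -/
noncomputable def riskGap (μ : Measure Z) (ℓ : (Fin N → Z) → Z → ℝ) (S : Fin N → Z) : ℝ :=
  ∫ z, ℓ S z ∂μ - (1 / (N : ℝ)) * ∑ i, ℓ S (S i)

theorem aemeasurable_riskGap {ℓ : (Fin N → Z) → Z → ℝ}
    (hℓ : AEMeasurable (fun q : (Fin N → Z) × Z => ℓ q.1 q.2)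
      ((Measure.pi fun _ : Fin N => μ).prod μ))
    (hℓi : ∀ i, AEMeasurable (fun S => ℓ S (S i)) (Measure.pi fun _ : Fin N => μ)) :
    AEMeasurable (riskGap μ ℓ) (Measure.pi fun _ : Fin N => μ) :=
  (hℓ.aestronglyMeasurable.integral_prod_right').aemeasurable.sub
    ((Finset.aemeasurable_fun_sum _ fun i _ => hℓi i).const_mul _)

/-- Exchanging a training sample with a fresh one bounds a weighted mean of the gap. -/
theorem integral_mul_riskGap_le (hN : 0 < N) {ℓ : (Fin N → Z) → Z → ℝ} {w : (Fin N → Z) → ℝ}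
    {κ : ℝ} (hw : Integrable w (Measure.pi fun _ : Fin N => μ))
    (hwl : Integrable (fun q : (Fin N → Z) × Z => w q.1 * ℓ q.1 q.2)
      ((Measure.pi fun _ : Fin N => μ).prod μ))
    (hwi : ∀ i, Integrable (fun S => w S * ℓ S (S i)) (Measure.pi fun _ : Fin N => μ))
    (h : ∀ i S z, w S * (ℓ S z - κ) ≤
      w (Function.update S i z) * ℓ (Function.update S i z) z) :
    ∫ S, w S * riskGap μ ℓ S ∂(Measure.pi fun _ : Fin N => μ)
      ≤ κ * ∫ S, w S ∂(Measure.pi fun _ : Fin N => μ) := by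
  set P := Measure.pi fun _ : Fin N => μ with hP
  have hw1 : Integrable (fun q : (Fin N → Z) × Z => w q.1) (P.prod μ) := hw.comp_fst μ
  have key : ∀ i, ∫ q, w q.1 * ℓ q.1 q.2 ∂(P.prod μ) - κ * ∫ S, w S ∂P
      ≤ ∫ S, w S * ℓ S (S i) ∂P := by
    intro i
    have hmp := measurePreserving_update (μ := μ) i
    have hwi' : Integrable (fun S => w S * ℓ S (S i))
        ((P.prod μ).map fun q => Function.update q.1 i q.2) := by rw [hmp.map_eq]; exact hwi i
    -- After the exchange the `i`-th sample is the fresh point itself, so `h` compares the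
    -- integrands pointwise.
    have e1 : ∫ S, w S * ℓ S (S i) ∂P = ∫ q : (Fin N → Z) × Z,
        w (Function.update q.1 i q.2) * ℓ (Function.update q.1 i q.2) q.2 ∂(P.prod μ) := by
      conv_lhs => rw [hP, ← hmp.map_eq]
      rw [integral_map hmp.measurable.aemeasurable hwi'.aestronglyMeasurable]
      simp [hP]
    have e2 : ∫ q, w q.1 ∂(P.prod μ) = ∫ S, w S ∂P := by
      rw [integral_fun_fst]; simp
    rw [e1, ← e2, ← integral_const_mul, ← integral_sub hwl (hw1.const_mul κ)]
    refine integral_mono (hwl.sub (hw1.const_mul κ)) ?_ fun q => ?_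
    · have := hmp.integrable_comp_of_integrable (hwi i)
      simpa [Function.comp_def] using this
    · have := h i q.1 q.2
      linarith
  have e3 : ∫ S, w S * riskGap μ ℓ S ∂P = ∫ q, w q.1 * ℓ q.1 q.2 ∂(P.prod μ)
      - (1 / (N : ℝ)) * ∑ i, ∫ S, w S * ℓ S (S i) ∂P := by
    rw [← integral_finsetSum _ fun i _ => hwi i, ← integral_const_mul, integral_prod _ hwl,
      ← integral_sub hwl.integral_prod_left ((integrable_finsetSum _ fun i _ => hwi i).const_mul _)]
    refine integral_congr_ae (ae_of_all _ fun S => ?_)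
    simp only [riskGap, integral_const_mul, mul_sub, Finset.mul_sum]
    congr 1
    exact Finset.sum_congr rfl fun i _ => by ring
  have hNpos : (0 : ℝ) < N := by exact_mod_cast hN
  have hsum := Finset.card_nsmul_le_sum Finset.univ _ _ fun i _ => key i
  rw [Finset.card_univ, Fintype.card_fin, nsmul_eq_mul] at hsum
  have := mul_le_mul_of_nonneg_left hsum (show 0 ≤ 1 / (N : ℝ) by positivity)
  rw [← mul_assoc, one_div_mul_cancel hNpos.ne', one_mul] at this
  rw [e3]
  linarith

/-- The expected risk contributes `γ`, the unchanged samples at most `γ` on average, and the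
replaced one at most `1 / N`. -/
theorem abs_riskGap_sub_riskGap_update_le {ℓ : (Fin N → Z) → Z → ℝ} {γ : ℝ} (hN : 0 < N)
    (hℓint : ∀ S, Integrable (ℓ S) μ)
    (hstab : ∀ i S w z, |ℓ S z - ℓ (Function.update S i w) z| ≤ γ)
    (h01 : ∀ S z, ℓ S z ∈ Set.Icc (0 : ℝ) 1) (i : Fin N) (S : Fin N → Z) (w : Z) :
    |riskGap μ ℓ S - riskGap μ ℓ (Function.update S i w)| ≤ 2 * γ + 1 / N := by
  set S' := Function.update S i w with hS'
  have hNpos : (0 : ℝ) < N := by exact_mod_cast hN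
  have hγ : 0 ≤ γ := (abs_nonneg _).trans (hstab i S w w)
  have h1 : |∫ z, ℓ S z ∂μ - ∫ z, ℓ S' z ∂μ| ≤ γ := by
    rw [← integral_sub (hℓint _) (hℓint _)]
    simpa using norm_integral_le_of_norm_le_const (μ := μ) (f := fun z => ℓ S z - ℓ S' z)
      (ae_of_all _ fun z => hstab i S w z)
  have h2 : |∑ j, (ℓ S (S j) - ℓ S' (S' j))| ≤ N * γ + 1 := by
    refine (Finset.abs_sum_le_sum_abs _ _).trans ?_
    rw [← Finset.add_sum_erase _ _ (Finset.mem_univ i)]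
    have a1 : |ℓ S (S i) - ℓ S' (S' i)| ≤ 1 := by
      have := h01 S (S i)
      have := h01 S' (S' i)
      rw [abs_le]; constructor <;> linarith [this.1, this.2, (h01 S (S i)).1, (h01 S (S i)).2]
    have a2 : ∑ j ∈ Finset.univ.erase i, |ℓ S (S j) - ℓ S' (S' j)| ≤ N * γ := by
      refine (Finset.sum_le_card_nsmul _ _ γ fun j hj => ?_).trans ?_
      · have : S' j = S j := Function.update_of_ne (Finset.ne_of_mem_erase hj) _ _
        rw [this]
        exact hstab i S w _
      · rw [nsmul_eq_mul]
        refine mul_le_mul_of_nonneg_right ?_ hγ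
        exact_mod_cast (Finset.card_le_univ _).trans (by simp)
    linarith
  have h3 : |(1 / (N : ℝ)) * ∑ j, (ℓ S (S j) - ℓ S' (S' j))| ≤ γ + 1 / N := by
    rw [abs_mul, abs_of_nonneg (show 0 ≤ 1 / (N : ℝ) by positivity)]
    refine (mul_le_mul_of_nonneg_left h2 (by positivity)).trans (le_of_eq ?_)
    field_simp
  rw [Finset.sum_sub_distrib, mul_sub] at h3
  rw [abs_le] at *
  simp only [riskGap]
  constructor <;> linarith [h1.1, h1.2, h3.1, h3.2]

theorem abs_riskGap_le_one {ℓ : (Fin N → Z) → Z → ℝ} (hℓint : ∀ S, Integrable (ℓ S) μ)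
    (h01 : ∀ S z, ℓ S z ∈ Set.Icc (0 : ℝ) 1) (S : Fin N → Z) : |riskGap μ ℓ S| ≤ 1 := by
  have h1 : 0 ≤ ∫ z, ℓ S z ∂μ := integral_nonneg fun z => (h01 S z).1
  have h2 : ∫ z, ℓ S z ∂μ ≤ 1 := by
    simpa using integral_mono (hℓint S) (integrable_const 1) fun z => (h01 S z).2
  have h3 : 0 ≤ (1 / (N : ℝ)) * ∑ i, ℓ S (S i) :=
    mul_nonneg (by positivity) (Finset.sum_nonneg fun i _ => (h01 S _).1)
  have h4 : (1 / (N : ℝ)) * ∑ i, ℓ S (S i) ≤ 1 := by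
    have : ∑ i, ℓ S (S i) ≤ N := by
      simpa using Finset.sum_le_card_nsmul Finset.univ _ 1 fun i _ => (h01 S (S i)).2
    rw [one_div_mul_eq_div]
    exact div_le_one_of_le₀ this (by positivity)
  rw [abs_le]
  simp only [riskGap]
  constructor <;> linarith

/-- The moment generating function of the gap of a uniformly stable algorithm is
sub-Gaussian, with a variance proxy that does not grow with the size of the training set. -/
theorem mgf_riskGap_le (hN : 0 < N) {ℓ : (Fin N → Z) → Z → ℝ} {γ : ℝ}
    (hℓ : AEMeasurable (fun q : (Fin N → Z) × Z => ℓ q.1 q.2)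
      ((Measure.pi fun _ : Fin N => μ).prod μ))
    (hℓi : ∀ i, AEMeasurable (fun S => ℓ S (S i)) (Measure.pi fun _ : Fin N => μ))
    (hℓint : ∀ S, Integrable (ℓ S) μ)
    (hstab : ∀ i S w z, |ℓ S z - ℓ (Function.update S i w) z| ≤ γ)
    (h01 : ∀ S z, ℓ S z ∈ Set.Icc (0 : ℝ) 1) {t : ℝ} (ht : 0 ≤ t) :
    mgf (riskGap μ ℓ) (Measure.pi fun _ : Fin N => μ) t ≤
      Real.exp ((2 * γ + 1 / N) * t ^ 2 / 2 + γ * t) := by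
  set P := Measure.pi fun _ : Fin N => μ with hP
  set b := 2 * γ + 1 / (N : ℝ) with hb
  have hΔ : AEMeasurable (riskGap μ ℓ) P := aemeasurable_riskGap hℓ hℓi
  have hexp : ∀ t, Integrable (fun S => Real.exp (t * riskGap μ ℓ S)) P := fun t =>
    integrable_exp_mul_of_mem_Icc (a := -1) (b := 1) hΔ
      (ae_of_all _ fun S => abs_le.1 (abs_riskGap_le_one hℓint h01 S))
  have hset : interior (integrableExpSet (riskGap μ ℓ) P) = Set.univ := by
    rw [show integrableExpSet (riskGap μ ℓ) P = Set.univ from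
      Set.eq_univ_of_forall hexp, interior_univ]
  have hderiv : ∀ t, HasDerivAt (mgf (riskGap μ ℓ) P)
      (∫ S, riskGap μ ℓ S * Real.exp (t * riskGap μ ℓ S) ∂P) t := fun t =>
    hasDerivAt_mgf (hset ▸ Set.mem_univ t)
  -- The derivative of the moment generating function is a weighted mean of the gap, with weight
  -- `exp (t * gap)` and `κ = t * b + γ`.
  have hle : ∀ t, 0 ≤ t → ∫ S, riskGap μ ℓ S * Real.exp (t * riskGap μ ℓ S) ∂P
      ≤ (t * b + γ) * mgf (riskGap μ ℓ) P t := by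
    intro t ht
    simp_rw [mul_comm (riskGap μ ℓ _)]
    refine integral_mul_riskGap_le hN (hexp t) ?_ (fun i => ?_) fun i S z => ?_
    · refine ((hexp t).comp_fst μ).mul_bdd (c := 1) hℓ.aestronglyMeasurable (ae_of_all _ fun q => ?_)
      rw [Real.norm_of_nonneg (h01 _ _).1]
      exact (h01 _ _).2
    · refine (hexp t).mul_bdd (c := 1) (hℓi i).aestronglyMeasurable (ae_of_all _ fun q => ?_)
      rw [Real.norm_of_nonneg (h01 _ _).1]
      exact (h01 _ _).2
    · have hb1 := (abs_le.1 (abs_riskGap_sub_riskGap_update_le hN hℓint hstab h01 i S z)).2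
      rw [← hb] at hb1
      have hs := (abs_le.1 (hstab i S z z)).2
      set S' := Function.update S i z
      have hw : Real.exp (t * riskGap μ ℓ S) * (1 - t * b) ≤ Real.exp (t * riskGap μ ℓ S') := by
        have h1 : 1 - t * b ≤ Real.exp (-(t * b)) := by
          have := Real.add_one_le_exp (-(t * b)); linarith
        refine (mul_le_mul_of_nonneg_left h1 (Real.exp_pos _).le).trans ?_
        rw [← Real.exp_add, Real.exp_le_exp]
        have := mul_le_mul_of_nonneg_left hb1 ht
        linarith
      -- It remains that `ℓ S z - (t * b + γ) ≤ (1 - t * b) * ℓ S' z`, by stability and `ℓ S' z ≤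
      -- 1`.
      refine le_trans ?_ (mul_le_mul_of_nonneg_right hw (h01 S' z).1)
      rw [mul_assoc]
      refine mul_le_mul_of_nonneg_left ?_ (Real.exp_pos _).le
      have hγ : 0 ≤ γ := (abs_nonneg _).trans (hstab i S z z)
      have hb0 : 0 ≤ t * b := by positivity
      have := mul_le_mul_of_nonneg_left (h01 S' z).2 hb0
      linarith
  have hder : ∀ t, HasDerivAt
      (fun t => mgf (riskGap μ ℓ) P t * Real.exp (-(b * t ^ 2 / 2 + γ * t)))
      ((∫ S, riskGap μ ℓ S * Real.exp (t * riskGap μ ℓ S) ∂P)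
          * Real.exp (-(b * t ^ 2 / 2 + γ * t))
        + mgf (riskGap μ ℓ) P t * (Real.exp (-(b * t ^ 2 / 2 + γ * t)) * -(t * b + γ))) t := by
    intro t
    refine (hderiv t).mul (HasDerivAt.exp ?_)
    refine HasDerivAt.neg ?_
    have h1 : HasDerivAt (fun t : ℝ => b * t ^ 2 / 2) (t * b) t :=
      (((hasDerivAt_pow 2 t).const_mul b).div_const 2).congr_deriv (by push_cast; ring)
    exact h1.add (by simpa using (hasDerivAt_id t).const_mul γ)
  -- Grönwall's argument: `hle` says that this quotient, equal to `1` at `0`, cannot increase.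
  have hanti : AntitoneOn
      (fun t => mgf (riskGap μ ℓ) P t * Real.exp (-(b * t ^ 2 / 2 + γ * t))) (Set.Ici 0) := by
    refine antitoneOn_of_deriv_nonpos (convex_Ici 0)
      (fun t _ => (hder t).continuousAt.continuousWithinAt)
      (fun t _ => (hder t).differentiableAt.differentiableWithinAt) fun t ht => ?_
    rw [interior_Ici] at ht
    rw [(hder t).deriv]
    have := mul_le_mul_of_nonneg_right (hle t (le_of_lt ht))
      (Real.exp_pos (-(b * t ^ 2 / 2 + γ * t))).le
    linarith
  have h0 := hanti Set.self_mem_Ici (Set.mem_Ici.2 ht) ht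
  simp only [mgf_zero, ne_eq, OfNat.ofNat_ne_zero, not_false_eq_true, zero_pow, mul_zero, zero_div,
    add_zero, neg_zero, Real.exp_zero, mul_one] at h0
  rwa [Real.exp_neg, ← div_eq_mul_inv, div_le_one (Real.exp_pos _)] at h0

/-- The generalization bound of uniformly stable algorithms. -/
theorem one_sub_le_measureReal_riskGap_le (hN : 0 < N) {ℓ : (Fin N → Z) → Z → ℝ} {γ : ℝ}
    (hγ : 0 ≤ γ)
    (hℓ : AEMeasurable (fun q : (Fin N → Z) × Z => ℓ q.1 q.2)
      ((Measure.pi fun _ : Fin N => μ).prod μ))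
    (hℓi : ∀ i, AEMeasurable (fun S => ℓ S (S i)) (Measure.pi fun _ : Fin N => μ))
    (hℓint : ∀ S, Integrable (ℓ S) μ)
    (hstab : ∀ i S w z, |ℓ S z - ℓ (Function.update S i w) z| ≤ γ)
    (h01 : ∀ S z, ℓ S z ∈ Set.Icc (0 : ℝ) 1) {δ : ℝ} (hδ : 0 < δ) (hδ1 : δ < 1) :
    1 - δ ≤ (Measure.pi fun _ : Fin N => μ).real
      {S | riskGap μ ℓ S ≤ 8 * Real.sqrt ((2 * γ + 1 / N) * Real.log (8 / δ))} := by
  set P := Measure.pi fun _ : Fin N => μ with hP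
  set b := 2 * γ + 1 / (N : ℝ) with hb
  have hNpos : (0 : ℝ) < N := by exact_mod_cast hN
  have hbpos : 0 < b := by positivity
  obtain ⟨l, hl⟩ : ∃ l, l = Real.log (8 / δ) := ⟨_, rfl⟩
  have hl1 : 1 ≤ l := by
    rw [hl, Real.le_log_iff_exp_le (by positivity), le_div_iff₀ hδ]
    nlinarith [Real.exp_one_lt_d9, Real.exp_pos 1]
  rw [← hl]
  -- The gap never exceeds `1`, so only `8 * r < 1`, with `r = √(b * l)`, needs the tail estimate.
  rcases le_or_gt 1 (8 * Real.sqrt (b * l)) with hε | hε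
  · have : {S | riskGap μ ℓ S ≤ 8 * Real.sqrt (b * l)} = Set.univ :=
      Set.eq_univ_of_forall fun S => ((le_abs_self _).trans (abs_riskGap_le_one hℓint h01 S)).trans hε
    rw [this, probReal_univ]
    linarith
  · have hΔ : AEMeasurable (riskGap μ ℓ) P := aemeasurable_riskGap hℓ hℓi
    obtain ⟨r, hr⟩ : ∃ r, r = Real.sqrt (b * l) := ⟨_, rfl⟩
    rw [← hr] at hε ⊢
    have hbl : r ^ 2 = b * l := by rw [hr]; exact Real.sq_sqrt (by positivity)
    have hr0 : 0 ≤ r := hr ▸ Real.sqrt_nonneg _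
    -- At `t = r / b` the Chernoff exponent is at most `-8 * l + l / 2 + r / 2`, since `2 * γ ≤ b`;
    -- as `r < 1 / 8` and `1 ≤ l`, this is below `-l`.
    have ht : 0 ≤ r / b := by positivity
    have hch := measure_ge_le_exp_mul_mgf (μ := P) (X := riskGap μ ℓ) (8 * r) ht
      (integrable_exp_mul_of_mem_Icc (a := -1) (b := 1) hΔ
        (ae_of_all _ fun S => abs_le.1 (abs_riskGap_le_one hℓint h01 S)))
    have hmgf := mgf_riskGap_le hN hℓ hℓi hℓint hstab h01 ht
    have htail : P.real {S | 8 * r ≤ riskGap μ ℓ S} ≤ δ := by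
      refine hch.trans ((mul_le_mul_of_nonneg_left hmgf (Real.exp_pos _).le).trans ?_)
      rw [← Real.exp_add, ← hb]
      have e1 : -(r / b) * (8 * r) = -(8 * l) := by
        have : r / b * r = l := by
          rw [div_mul_eq_mul_div, ← sq, hbl]; field_simp
        linear_combination -8 * this
      have e2 : b * (r / b) ^ 2 / 2 = l / 2 := by
        rw [div_pow, hbl]; field_simp
      have e3 : γ * (r / b) ≤ r / 2 := by
        rw [← mul_div_assoc, div_le_iff₀ hbpos]
        have h2 : 2 * γ ≤ b := by rw [hb]; linarith [show 0 < 1 / (N : ℝ) by positivity]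
        nlinarith
      rw [e1, e2]
      have h8 : Real.exp (-l) = δ / 8 := by
        rw [hl, Real.exp_neg, Real.exp_log (by positivity), inv_div]
      calc Real.exp (-(8 * l) + (l / 2 + γ * (r / b))) ≤ Real.exp (-l) :=
            Real.exp_le_exp.2 (by linarith)
        _ ≤ δ := by rw [h8]; linarith
    -- Subadditivity replaces the complement rule, so neither set has to be measurable.
    have hcover : (1 : ℝ) ≤ P.real {S | riskGap μ ℓ S ≤ 8 * r}
        + P.real {S | 8 * r ≤ riskGap μ ℓ S} := by
      rw [← probReal_univ (μ := P)]
      refine (measureReal_mono fun S _ => ?_).trans (measureReal_union_le _ _)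
      exact le_total (riskGap μ ℓ S) (8 * r)
    linarith

end Generalization

/-! ### Weight vectors and the RKHS norm. -/

section FeatureMap

variable {X : Type*} {d : ℕ} {H : Type*} [NormedAddCommGroup H] [InnerProductSpace ℝ H]
  [CompleteSpace H] [RKHS ℝ H X ℝ] {φ : X → EuclideanSpace ℝ (Fin d)}

/-- The map `α ↦ α^⊤ φ(·)` is linear. -/
noncomputable def linearClassifierₗ (hφ : IsFeatureMap H φ) : EuclideanSpace ℝ (Fin d) →ₗ[ℝ] H where
  toFun := linearClassifier hφ
  map_add' α β := RKHS.ext fun x => by simp [linearClassifier_apply, inner_add_left]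
  map_smul' c α := RKHS.ext fun x => by simp [linearClassifier_apply, inner_smul_left]

theorem linearClassifierₗ_apply (hφ : IsFeatureMap H φ) (α : EuclideanSpace ℝ (Fin d)) :
    linearClassifierₗ hφ α = linearClassifier hφ α := rfl

theorem linearClassifierₗ_feature (hφ : IsFeatureMap H φ) (y : X) :
    linearClassifierₗ hφ (φ y) = RKHS.kerFun H y 1 :=
  RKHS.ext fun x => by
    rw [linearClassifierₗ_apply, linearClassifier_apply, RKHS.kerFun_apply, hφ, real_inner_comm]

/-- The range is finite-dimensional, hence closed, and contains the kernel functions, whose span is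
dense. -/
theorem linearClassifierₗ_surjective (hφ : IsFeatureMap H φ) :
    Function.Surjective (linearClassifierₗ hφ) := by
  rw [← LinearMap.range_eq_top, eq_top_iff, ← RKHS.kerFun_dense H]
  refine Submodule.topologicalClosure_minimal _ (Submodule.span_le.2 ?_)
    (Submodule.closed_of_finiteDimensional _)
  rintro _ ⟨x, v, rfl⟩
  refine ⟨v • φ x, ?_⟩
  rw [map_smul, linearClassifierₗ_feature, ← map_smul, smul_eq_mul, mul_one]

/-- For a feature vector this is the reproducing property. One argument must lie in the span, since
the map kills the orthogonal complement. -/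
theorem inner_linearClassifierₗ (hφ : IsFeatureMap H φ) (α : EuclideanSpace ℝ (Fin d))
    {v : EuclideanSpace ℝ (Fin d)} (hv : v ∈ Submodule.span ℝ (Set.range φ)) :
    inner ℝ (linearClassifierₗ hφ α) (linearClassifierₗ hφ v) = inner ℝ α v := by
  induction hv using Submodule.span_induction with
  | mem v hv =>
    obtain ⟨y, rfl⟩ := hv
    rw [linearClassifierₗ_feature, RKHS.inner_kerFun, linearClassifierₗ_apply,
      linearClassifier_apply]
    simp
  | zero => simp
  | add u v _ _ hu hv => rw [map_add, inner_add_right, inner_add_right, hu, hv]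
  | smul c v _ hv => rw [map_smul, inner_smul_right, inner_smul_right, hv]

/-- Every element of the RKHS is a linear classifier with a weight vector of the same norm. -/
theorem exists_linearClassifier_eq_norm_eq (hφ : IsFeatureMap H φ) (f : H) :
    ∃ v, linearClassifierₗ hφ v = f ∧ ‖v‖ = ‖f‖ := by
  obtain ⟨α, rfl⟩ := linearClassifierₗ_surjective hφ f
  set V := Submodule.span ℝ (Set.range φ)
  have hv := V.starProjection_apply_mem α
  have he : linearClassifierₗ hφ (V.starProjection α) = linearClassifierₗ hφ α :=
    RKHS.ext fun x => by
      have h0 := (Submodule.mem_orthogonal' V _).1 (V.sub_starProjection_mem_orthogonal α) (φ x)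
        (Submodule.subset_span ⟨x, rfl⟩)
      rw [inner_sub_left] at h0
      simp only [linearClassifierₗ_apply, linearClassifier_apply]
      linarith
  refine ⟨_, he, ?_⟩
  rw [← he, ← sq_eq_sq₀ (norm_nonneg _) (norm_nonneg _), ← real_inner_self_eq_norm_sq,
    ← real_inner_self_eq_norm_sq, inner_linearClassifierₗ hφ _ hv]

theorem isSeparable_of_isFeatureMap (hφ : IsFeatureMap H φ) (C : Set H) :
    TopologicalSpace.IsSeparable C := by
  have hc : Continuous (linearClassifierₗ hφ) := LinearMap.continuous_of_finiteDimensional _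
  refine (TopologicalSpace.isSeparable_range hc).mono ?_
  rw [(linearClassifierₗ_surjective hφ).range_eq]
  exact Set.subset_univ C

theorem norm_gradient_eq_norm_fderiv {E : Type*} [NormedAddCommGroup E] [InnerProductSpace ℝ E]
    [CompleteSpace E] (f : E → ℝ) (x : E) : ‖gradient f x‖ = ‖fderiv ℝ f x‖ :=
  (InnerProductSpace.toDual ℝ E).symm.norm_map _

/-- The loss is Lipschitz on the feasible set, with constant `gradientBound`. -/
theorem abs_loss_sub_le_gradientBound_mul {p a : ℕ} (hφ : IsFeatureMap H φ)
    {L : H → Sample X p → ℝ} {Ω : H → Fin a → ℝ}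
    (hLdiff : ∀ s, Differentiable ℝ (fun α => L (linearClassifier hφ α) s))
    (hC : Convex ℝ {f | Ω f ≤ 0}) (hG : BddAbove (gradientNorms hφ L Ω)) (s : Sample X p)
    {f g : H} (hf : Ω f ≤ 0) (hg : Ω g ≤ 0) :
    |L f s - L g s| ≤ gradientBound hφ L Ω * ‖f - g‖ := by
  obtain ⟨β, rfl⟩ := linearClassifierₗ_surjective hφ g
  -- Lifting the difference, not `f` and `g` separately, makes the distance in weight space equal to
  -- `‖f - g‖`; the mean value inequality then applies on the convex preimage of the feasible set.
  obtain ⟨v, hv, hvn⟩ := exists_linearClassifier_eq_norm_eq hφ (f - linearClassifierₗ hφ β)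
  have hfv : f = linearClassifierₗ hφ (β + v) := by rw [map_add, hv]; abel
  rw [← hvn]
  have h := (hC.is_linear_preimage (linearClassifierₗ hφ).isLinear).norm_image_sub_le_of_norm_fderiv_le
    (𝕜 := ℝ) (f := fun α => L (linearClassifier hφ α) s) (C := gradientBound hφ L Ω)
    (x := β) (y := β + v) (fun α _ => hLdiff s α) (fun α hα => ?_) hg
    (by simpa [← hfv] using hf)
  · rw [add_sub_cancel_left] at h
    rw [hfv]
    exact h
  · rw [← norm_gradient_eq_norm_fderiv]
    exact le_csSup hG ⟨α, s, hα, rfl⟩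

theorem gradientBound_nonneg {p a : ℕ} (hφ : IsFeatureMap H φ) (L : H → Sample X p → ℝ)
    (Ω : H → Fin a → ℝ) : 0 ≤ gradientBound hφ L Ω :=
  Real.sSup_nonneg fun r hr => by
    obtain ⟨α, s, -, rfl⟩ := hr
    exact norm_nonneg _

end FeatureMap

end StableFair

/-! ### The two bounds for the constrained, regularized algorithm. -/

theorem corollary3p7
    {X : Type*} [MeasurableSpace X] {p d a N : ℕ} (hN : 0 < N)
    -- the distribution of the samples
    (μ : Measure (StableFair.Sample X p)) [IsProbabilityMeasure μ]
    -- the space of classifiers: the RKHS with kernel `⟨φ(x), φ(y)⟩`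
    {H : Type*} [NormedAddCommGroup H] [InnerProductSpace ℝ H] [CompleteSpace H] [RKHS ℝ H X ℝ]
    {φ : X → EuclideanSpace ℝ (Fin d)} (hφ : StableFair.IsFeatureMap H φ)
    -- the loss function and the fairness constraint
    (L : H → StableFair.Sample X p → ℝ) (Ω : H → Fin a → ℝ)
    (hLconv : ∀ s, ConvexOn ℝ Set.univ (fun f => L f s))
    (hLdiff : ∀ s, Differentiable ℝ (fun α => L (StableFair.linearClassifier hφ α) s))
    (hLint : ∀ f, Ω f ≤ 0 → Integrable (L f) μ)
    (hΩ : ConvexOn ℝ Set.univ Ω)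
    (hG : BddAbove (StableFair.gradientNorms hφ L Ω))
    -- the algorithm
    {lam : ℝ} (hlam : 0 < lam)
    (A : (Fin N → StableFair.Sample X p) → H) (hA : StableFair.SolvesStableFair L Ω lam A) :
    (Integrable (fun S => StableFair.expectedRisk μ L (A S) - StableFair.empiricalRisk L S (A S))
        (Measure.pi fun _ : Fin N => μ) ∧
      ∫ S, (StableFair.expectedRisk μ L (A S) - StableFair.empiricalRisk L S (A S))
          ∂(Measure.pi fun _ : Fin N => μ)
        ≤ StableFair.gradientBound hφ L Ω ^ 2 / (lam * N)) ∧
    ((∀ S s, L (A S) s ∈ Set.Icc (0 : ℝ) 1) →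
      ∀ δ : ℝ, 0 < δ → δ < 1 →
        1 - δ ≤ (Measure.pi fun _ : Fin N => μ).real
          {S | StableFair.expectedRisk μ L (A S) ≤ StableFair.empiricalRisk L S (A S) +
            8 * Real.sqrt ((2 * StableFair.gradientBound hφ L Ω ^ 2 / (lam * N) + 1 / N) *
              Real.log (8 / δ))}) := by
  obtain ⟨Z0⟩ : Nonempty (StableFair.Sample X p) := μ.nonempty_of_neZero
  have hNpos : (0 : ℝ) < N := by exact_mod_cast hN
  set G := StableFair.gradientBound hφ L Ω with hGdef
  have hG0 : 0 ≤ G := StableFair.gradientBound_nonneg hφ L Ω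
  have hC : Convex ℝ {f | Ω f ≤ 0} := by simpa using hΩ.convex_le 0
  have hlip : ∀ z, ∀ f ∈ {f | Ω f ≤ 0}, ∀ g ∈ {f | Ω f ≤ 0}, |L f z - L g z| ≤ G * ‖f - g‖ :=
    fun z f hf g hg => StableFair.abs_loss_sub_le_gradientBound_mul hφ hLdiff hC hG z hf hg
  have hconv : ∀ z, ConvexOn ℝ {f | Ω f ≤ 0} (fun f => L f z) := fun z =>
    (hLconv z).subset (Set.subset_univ _) hC
  have hAC : ∀ S, A S ∈ {f | Ω f ≤ 0} := fun S => (hA S).1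
  have hmin : ∀ S, IsMinOn (fun f => (1 / (N : ℝ)) * ∑ i, L f (S i) + lam * ‖f‖ ^ 2)
      {f | Ω f ≤ 0} (A S) := fun S => isMinOn_iff.2 (hA S).2
  obtain ⟨hm, hmi⟩ := StableFair.aemeasurable_loss_minimizer hC
    (StableFair.isSeparable_of_isFeatureMap hφ _) hconv hlip
    (fun f hf => (hLint f hf).aemeasurable) hlam hAC hmin
  have hdiff {S S' : Fin N → StableFair.Sample X p} (T : Finset (Fin N))
      (hST : ∀ i ∉ T, S i = S' i) (z) : |L (A S) z - L (A S') z| ≤ G ^ 2 / lam * (T.card / N) :=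
    StableFair.abs_loss_sub_le_of_eqOn_compl hC hconv hG0 hlip hlam hAC hmin T hST z
  have hstab : ∀ i S w z, |L (A S) z - L (A (Function.update S i w)) z| ≤ G ^ 2 / (lam * N) := by
    intro i S w z
    refine (hdiff {i} (fun j hj => ?_) z).trans (le_of_eq ?_)
    · rw [Function.update_of_ne (by simpa using hj)]
    · rw [Finset.card_singleton, Nat.cast_one, div_mul_div_comm, mul_one]
  -- The first bound assumes no bounded loss; comparison with a constant training set gives an
  -- integrable envelope independent of `S`.
  have hbdd : ∀ S z, ‖L (A S) z‖ ≤ |L (A fun _ => Z0) z| + G ^ 2 / lam := by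
    intro S z
    have h := hdiff (S := S) (S' := fun _ => Z0) Finset.univ (by simp) z
    rw [Finset.card_univ, Fintype.card_fin, div_self hNpos.ne', mul_one] at h
    have := abs_sub_abs_le_abs_sub (L (A S) z) (L (A fun _ => Z0) z)
    rw [Real.norm_eq_abs]
    linarith
  have hbint : Integrable (fun z => |L (A fun _ => Z0) z| + G ^ 2 / lam) μ :=
    (hLint _ (hAC _)).abs.add (integrable_const _)
  have hint : Integrable (fun q : (Fin N → StableFair.Sample X p) × StableFair.Sample X p =>
      L (A q.1) q.2) ((Measure.pi fun _ : Fin N => μ).prod μ) :=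
    (hbint.comp_snd _).mono' hm.aestronglyMeasurable (ae_of_all _ fun q => hbdd _ _)
  have hinti : ∀ i, Integrable (fun S => L (A S) (S i)) (Measure.pi fun _ : Fin N => μ) := fun i =>
    ((measurePreserving_eval (fun _ : Fin N => μ) i).integrable_comp_of_integrable hbint).mono'
      (hmi i).aestronglyMeasurable (ae_of_all _ fun S => hbdd _ _)
  refine ⟨⟨?_, ?_⟩, fun h01 δ hδ hδ1 => ?_⟩
  · exact hint.integral_prod_left.sub ((integrable_finsetSum _ fun i _ => hinti i).const_mul _)
  · have := StableFair.integral_mul_riskGap_le (μ := μ) (ℓ := fun S z => L (A S) z)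
      (w := fun _ => 1) (κ := G ^ 2 / (lam * N)) hN (integrable_const _)
      (by simpa using hint) (by simpa using hinti) (fun i S z => by
        have := (abs_le.1 (hstab i S z z)).2
        simp only [one_mul]
        linarith)
    simpa [StableFair.riskGap, StableFair.expectedRisk, StableFair.empiricalRisk] using this
  · have := StableFair.one_sub_le_measureReal_riskGap_le (μ := μ) (ℓ := fun S z => L (A S) z) hN
      (by positivity) hm hmi (fun S => hLint _ (hAC S)) hstab h01 hδ hδ1
    rw [← mul_div_assoc] at this
    refine this.trans (measureReal_mono fun S hS => ?_)
    rw [Set.mem_ofPred_eq, StableFair.riskGap, sub_le_iff_le_add'] at hS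
    exact hS
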